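/- Let $d\in\{2,3\}$, let $n\ge 3$ be an integer, and let $\alpha\in(0,1]$ and $\beta\in[0,3)$. Put $$R_{\mathrm{MDS}} = 32\left(\frac{12\log n}{\alpha(n-2)}\right)^{1/d},$$ and let $R$ be a radio range with $(1/\alpha)^{1/d}R_{\mathrm{MDS}} < R \le 1$. Let $x_1,\dots,x_n$ be independent and uniformly distributed in $[0,1]^d$, and let $X\in\mathbb{R}^{n\times d}$ be the matrix with rows $x_i$. Given the positions, let $G$ be the random graph on $\{1,\dots,n\}$ in which distinct nodes $i,j$ with $\|x_i-x_j\|\le R$ are joined by an edge with probability $p(\|x_i-x_j\|)$, where $$p(z)=\min\left(1,\alpha\left(\frac{z}{R}\right)^{-\beta}\right),$$ independently over pairs, and nodes at distance greater than $R$ are not joined. Only $G$ is observed. The MDS-MAP estimate $\widehat X\in\mathbb{R}^{n\times d}$ is computed from $G$ (and $R$, $d$) as follows. Let $\widehat D_{ij}=(R\,h_{ij})^2$, where $h_{ij}$ is the number of hops on a shortest path from $i$ to $j$ in $G$ ($h_{ii}=0$). Let $L=I_n-\frac1n\mathbf 1\mathbf 1^T$, take a singular value decomposition $-\frac12 L\widehat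 D L=U\Sigma V^T$ with the singular values in decreasing order, and put $\widehat X=U_d\Sigma_d^{1/2}$, where $U_d$ consists of the first $d$ columns of $U$ and $\Sigma_d$ is the diagonal matrix of the $d$ largest singular values. Then, with probability larger than $1-1/n^4$, the graph $G$ is connected (so that $\widehat D$ is well defined) and, for every choice of the singular value decomposition, $$d_{\mathrm{inv}}(X,\widehat X)=\frac1n\left\|LXX^TL-L\widehat X\widehat X^TL\right\|_F\le\frac{R_{\mathrm{MDS}}}{R}+20R,$$ where $\|\cdot\|_F$ is the Frobenius norm. -/

import Mathlib

open MeasureTheory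

noncomputable section

/-- The unit cube `[0,1]^d` in Euclidean `d`-space. -/
def unitCube (d : ℕ) : Set (EuclideanSpace ℝ (Fin d)) :=
  {x | ∀ k, x k ∈ Set.Icc (0 : ℝ) 1}

/-- The detection probability `p(z) = min(1, α (z/R)^{-β})` of two nodes at distance `z`.
At `z = 0` with `β > 0` the power is `+∞`, so that the minimum is `1`; this is spelled out because
`Real.rpow` has another convention there. -/
def detectionProb (α β R z : ℝ) : ℝ :=
  if z = 0 ∧ 0 < β then 1 else min 1 (α * (z / R) ^ (-β))

/-- An outcome of the random network on `n` nodes: the node positions, and for every unordered pair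
of nodes a mark that decides whether the detection between them succeeds. -/
abbrev NetworkOutcome (n d : ℕ) : Type :=
  (Fin n → EuclideanSpace ℝ (Fin d)) × (Sym2 (Fin n) → ℝ)

/-- The law of the network: positions are independent and uniform on `[0,1]^d`, marks are independent
and uniform on `[0,1]`, and positions and marks are independent of each other. -/
def networkLaw (n d : ℕ) : Measure (NetworkOutcome n d) :=
  (Measure.pi fun _ : Fin n => (volume : Measure (EuclideanSpace ℝ (Fin d))).restrict (unitCube d)).prod
    (Measure.pi fun _ : Sym2 (Fin n) => (volume : Measure ℝ).restrict (Set.Icc 0 1))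

instance networkLaw_isProbabilityMeasure (n d : ℕ) : IsProbabilityMeasure (networkLaw n d) := by
  have h1 : IsProbabilityMeasure
      ((volume : Measure (EuclideanSpace ℝ (Fin d))).restrict (unitCube d)) := by
    constructor
    have h : unitCube d =
        (MeasurableEquiv.toLp 2 (Fin d → ℝ)).symm ⁻¹' (Set.univ.pi fun _ => Set.Icc (0 : ℝ) 1) := by
      ext x
      simp only [unitCube, Set.mem_ofPred_eq, Set.mem_preimage, Set.mem_univ_pi]
      rfl
    rw [Measure.restrict_apply_univ, h,
      (EuclideanSpace.volume_preserving_symm_measurableEquiv_toLp (Fin d)).measure_preimage_equiv,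
      volume_pi, Measure.pi_pi]
    simp
  have h2 : IsProbabilityMeasure ((volume : Measure ℝ).restrict (Set.Icc 0 1)) := ⟨by simp⟩
  unfold networkLaw
  infer_instance

/-- The connectivity graph. Two distinct nodes at distance `z` are never adjacent if `z > R`; if
`z ≤ R` they are adjacent exactly when the mark of the pair is at most `p(z)`. So, given
the positions, the pairs within range `R` are detected independently with probability `p(z)`. -/
def connectivityGraph {n d : ℕ} (α β R : ℝ) (ω : NetworkOutcome n d) : SimpleGraph (Fin n) where
  Adj i j := i ≠ j ∧ dist (ω.1 i) (ω.1 j) ≤ R ∧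
    ω.2 s(i, j) ≤ detectionProb α β R (dist (ω.1 i) (ω.1 j))
  symm := ⟨fun i j h => by
    rw [dist_comm, Sym2.eq_swap]
    exact ⟨h.1.symm, h.2⟩⟩
  loopless := ⟨fun _ h => h.1 rfl⟩

/-- The position matrix `X`, whose `i`-th row is the position of node `i`. -/
def positionMatrix {n d : ℕ} (ω : NetworkOutcome n d) : Matrix (Fin n) (Fin d) ℝ :=
  Matrix.of fun i k => ω.1 i k

/-- The centering matrix `L = I - (1/n) 1 1ᵀ`. -/
def centering (n : ℕ) : Matrix (Fin n) (Fin n) ℝ :=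
  1 - (1 / (n : ℝ)) • Matrix.of fun _ _ => 1

/-- The Frobenius norm. -/
def frobNorm {n : ℕ} (A : Matrix (Fin n) (Fin n) ℝ) : ℝ :=
  Real.sqrt (∑ i, ∑ j, A i j ^ 2)

/-- `d_inv(X, Y) = (1/n) ‖L X Xᵀ L - L Y Yᵀ L‖_F`. -/
def dInv {n d : ℕ} (X Y : Matrix (Fin n) (Fin d) ℝ) : ℝ :=
  1 / (n : ℝ) * frobNorm (centering n * X * X.transpose * centering n
    - centering n * Y * Y.transpose * centering n)

/-- The squared shortest-path matrix of a connected graph: the length of a path is its number of hops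
times the radio range `R`. -/
def squaredShortestPaths {n : ℕ} (R : ℝ) (G : SimpleGraph (Fin n)) : Matrix (Fin n) (Fin n) ℝ :=
  Matrix.of fun i j => (R * (G.dist i j : ℝ)) ^ 2

/-- `Y` is an output of classical metric multidimensional scaling in dimension `d` on the matrix `D`:
for some singular value decomposition `-(1/2) L D L = U Σ Vᵀ`, singular values in decreasing
order, `Y = U_d Σ_d^{1/2}`, where `U_d` holds the first `d` left singular vectors and `Σ_d`
the first `d` singular values. -/
def IsMDS {n d : ℕ} (D : Matrix (Fin n) (Fin n) ℝ) (Y : Matrix (Fin n) (Fin d) ℝ) : Prop :=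
  ∃ hdn : d ≤ n, ∃ U ∈ Matrix.orthogonalGroup (Fin n) ℝ, ∃ V ∈ Matrix.orthogonalGroup (Fin n) ℝ,
    ∃ σ : Fin n → ℝ, Antitone σ ∧ (∀ k, 0 ≤ σ k) ∧
      (-(1 / 2) : ℝ) • (centering n * D * centering n) = U * Matrix.diagonal σ * V.transpose ∧
      Y = Matrix.of fun i k => U i (Fin.castLE hdn k) * Real.sqrt (σ (Fin.castLE hdn k))

/-- Multidimensional scaling of a symmetric matrix always has an output. -/
theorem exists_isMDS {n d : ℕ} (hdn : d ≤ n) (D : Matrix (Fin n) (Fin n) ℝ) (hD : D.IsSymm) :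
    ∃ Y : Matrix (Fin n) (Fin d) ℝ, IsMDS D Y := by
  set M := (-(1 / 2) : ℝ) • (centering n * D * centering n) with hM
  have hL : (centering n).transpose = centering n := by
    ext i j; simp [centering, Matrix.one_apply, eq_comm]
  have hMs : M.IsHermitian := by
    change M.conjTranspose = M
    rw [Matrix.conjTranspose_eq_transpose_of_trivial, hM, Matrix.transpose_smul,
      Matrix.transpose_mul, Matrix.transpose_mul, hL, hD.eq, Matrix.mul_assoc]
  have hs := hMs.spectral_theorem
  rw [Unitary.conjStarAlgAut_apply] at hs
  set W : Matrix (Fin n) (Fin n) ℝ := (hMs.eigenvectorUnitary).1 with hW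
  set ev := hMs.eigenvalues
  have hWW : W * W.transpose = 1 := by
    have := Unitary.coe_mul_star_self hMs.eigenvectorUnitary
    simpa [Matrix.star_eq_conjTranspose] using this
  set e : Equiv.Perm (Fin n) := Tuple.sort (fun i => -|ev i|) with he
  have hmono : Monotone ((fun i => -|ev i|) ∘ e) := Tuple.monotone_sort _
  let sg : Fin n → ℝ := fun i => if 0 ≤ ev i then 1 else -1
  have hsg : ∀ i, sg i * sg i = 1 := by intro i; simp only [sg]; split_ifs <;> norm_num
  have hsg2 : ∀ i, |ev i| * sg i = ev i := by
    intro i; simp only [sg]; split_ifs with h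
    · simp [abs_of_nonneg h]
    · simp [abs_of_neg (not_le.mp h)]
  have hent : ∀ i j, ∑ k, W i k * W j k = (1 : Matrix (Fin n) (Fin n) ℝ) i j := by
    intro i j; rw [← hWW]; simp [Matrix.mul_apply]
  refine ⟨_, hdn, Matrix.of fun i k => W i (e k), ?_, Matrix.of fun i k => W i (e k) * sg (e k), ?_,
    fun k => |ev (e k)|, ?_, fun k => abs_nonneg _, ?_, rfl⟩
  · rw [Matrix.mem_orthogonalGroup_iff]
    ext i j
    rw [Matrix.mul_apply]
    exact (Equiv.sum_comp e (fun k => W i k * W j k)).trans (hent i j)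
  · rw [Matrix.mem_orthogonalGroup_iff]
    ext i j
    rw [Matrix.mul_apply]
    refine (Equiv.sum_comp e (fun k => W i k * sg k * (W j k * sg k))).trans ?_
    rw [← hent]
    refine Finset.sum_congr rfl fun k _ => ?_
    linear_combination W i k * W j k * hsg k
  · intro a b hab
    have := hmono hab
    simp only [Function.comp] at this
    simpa using this
  · rw [← hM, hs]
    ext i j
    rw [Matrix.mul_apply, Matrix.mul_apply]
    simp only [Matrix.mul_diagonal]
    refine Eq.trans ?_ (Equiv.sum_comp e (fun k => W i k * |ev k| * (W j k * sg k))).symm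
    refine Finset.sum_congr rfl fun k _ => ?_
    have := hsg2 k
    change W i k * ev k * W j k = _
    linear_combination (- W i k * W j k) * this

/-- `Y` is an output of MDS-MAP on the connectivity graph `G` with radio range `R`. -/
def IsMDSMAP {n d : ℕ} (R : ℝ) (G : SimpleGraph (Fin n)) (Y : Matrix (Fin n) (Fin d) ℝ) : Prop :=
  IsMDS (squaredShortestPaths R G) Y

/-- `R_MDS = 32 (12 log n / (α (n - 2)))^{1/d}`. -/
def rMDS (n d : ℕ) (α : ℝ) : ℝ :=
  32 * (12 * Real.log n / (α * ((n : ℝ) - 2))) ^ (1 / (d : ℝ))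

end

/-! Scaling is stable (`IsMDS.dInv_le`). Let `D` be symmetric, `M = -(1/2) L D L = U Σ Vᵀ`, `Z = L
X`. Then `Y Yᵀ` truncates `|M| = U Σ Uᵀ`. Since `Z Zᵀ` is positive semidefinite, `|M|` is no farther
from it than `M`; since `Z Zᵀ` has rank at most `d`, truncating `|M|` costs no more than that
distance again. The resulting factor 2 cancels the 1/2 of double centering, so an entrywise bound on
squared hop lengths minus squared distances suffices.

Each edge has length at most `R`, so `D ≤ R h` for a pair at distance `D` with `h` hops. Conversely,
write `rMDS = 32 s`. If every far target can be approached by `R - 4 s` along one edge, and every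
node within range is reached in two edges, greedy routing gives `(h - 2)(R - 4 s) ≤ D`. Elementary
estimates then finish (`abs_sq_hops_sub_sq_dist_le`).

Such relays exist because within range the edge probability is at least `α`. A far relay lies in a
region of volume at least `s ^ d` and needs one edge; a near relay has volume at least `(R / 4) ^ d`
and needs two. Given the two end positions, the other `n - 2` nodes fail independently, so by the
choice of `s` a pair lacks a relay with probability at most `n⁻¹²`. A union bound over pairs
concludes. -/

/-! ### Frobenius norm and centering -/

theorem frobNorm_sq {n : ℕ} (A : Matrix (Fin n) (Fin n) ℝ) :
    frobNorm A ^ 2 = ∑ i, ∑ j, A i j ^ 2 :=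
  Real.sq_sqrt (Finset.sum_nonneg fun _ _ => Finset.sum_nonneg fun _ _ => sq_nonneg _)

theorem frobNorm_nonneg {n : ℕ} (A : Matrix (Fin n) (Fin n) ℝ) : 0 ≤ frobNorm A :=
  Real.sqrt_nonneg _

theorem frobNorm_sq_eq_trace {n : ℕ} (A : Matrix (Fin n) (Fin n) ℝ) :
    frobNorm A ^ 2 = (A.transpose * A).trace := by
  rw [frobNorm_sq, Finset.sum_comm]
  simp [Matrix.trace, Matrix.mul_apply, sq]

theorem frobNorm_add_le {n : ℕ} (A B : Matrix (Fin n) (Fin n) ℝ) :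
    frobNorm (A + B) ≤ frobNorm A + frobNorm B := by
  let _ := Matrix.frobeniusSeminormedAddCommGroup (m := Fin n) (n := Fin n) (α := ℝ)
  have h : ∀ C : Matrix (Fin n) (Fin n) ℝ, frobNorm C = ‖C‖ := by
    intro C
    rw [Matrix.frobenius_norm_def, frobNorm, Real.sqrt_eq_rpow]
    simp
  rw [h, h, h]
  exact norm_add_le A B

theorem frobNorm_transpose {n : ℕ} (A : Matrix (Fin n) (Fin n) ℝ) :
    frobNorm A.transpose = frobNorm A := by
  unfold frobNorm
  rw [Finset.sum_comm]
  rfl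

theorem frobNorm_neg {n : ℕ} (A : Matrix (Fin n) (Fin n) ℝ) : frobNorm (-A) = frobNorm A := by
  simp [frobNorm]

theorem frobNorm_smul {n : ℕ} (c : ℝ) (A : Matrix (Fin n) (Fin n) ℝ) :
    frobNorm (c • A) = |c| * frobNorm A := by
  have h : ∑ i, ∑ j, (c • A) i j ^ 2 = c ^ 2 * ∑ i, ∑ j, A i j ^ 2 := by
    simp [mul_pow, Finset.mul_sum]
  rw [frobNorm, h, Real.sqrt_mul (sq_nonneg c), Real.sqrt_sq_eq_abs, frobNorm]

theorem frobNorm_mul_left_of_orthogonal {n : ℕ} {U : Matrix (Fin n) (Fin n) ℝ}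
    (hU : U.transpose * U = 1) (A : Matrix (Fin n) (Fin n) ℝ) :
    frobNorm (U * A) = frobNorm A := by
  rw [← sq_eq_sq₀ (frobNorm_nonneg _) (frobNorm_nonneg _), frobNorm_sq_eq_trace,
    frobNorm_sq_eq_trace, Matrix.transpose_mul, Matrix.mul_assoc, ← Matrix.mul_assoc _ U A, hU,
    Matrix.one_mul]

theorem frobNorm_mul_right_of_orthogonal {n : ℕ} {U : Matrix (Fin n) (Fin n) ℝ}
    (hU : U * U.transpose = 1) (A : Matrix (Fin n) (Fin n) ℝ) :
    frobNorm (A * U) = frobNorm A := by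
  rw [← frobNorm_transpose, Matrix.transpose_mul, frobNorm_mul_left_of_orthogonal (by simpa using hU),
    frobNorm_transpose]

theorem frobNorm_le_of_forall_abs_le {n : ℕ} {A : Matrix (Fin n) (Fin n) ℝ} {c : ℝ} (hc : 0 ≤ c)
    (h : ∀ i j, |A i j| ≤ c) : frobNorm A ≤ n * c := by
  refine Real.sqrt_le_iff.2 ⟨by positivity, ?_⟩
  calc ∑ i, ∑ j, A i j ^ 2 ≤ ∑ _i : Fin n, ∑ _j : Fin n, c ^ 2 :=
        Finset.sum_le_sum fun i _ => Finset.sum_le_sum fun j _ => sq_le_sq' (abs_le.1 (h i j)).1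
          (abs_le.1 (h i j)).2
    _ = (n * c) ^ 2 := by simp; ring

theorem centering_transpose (n : ℕ) : (centering n).transpose = centering n := by
  ext i j; simp [centering, Matrix.one_apply, eq_comm]

theorem centering_mul_ones (n : ℕ) :
    centering n * Matrix.of (fun _ _ => 1 : Fin n → Fin n → ℝ) = 0 := by
  ext i j
  have hn : (n : ℝ) ≠ 0 := by
    have := i.pos
    positivity
  simp [centering, Matrix.mul_apply, Matrix.one_apply, Finset.sum_sub_distrib, hn]

theorem centering_mul_self (n : ℕ) : centering n * centering n = centering n := by
  conv_lhs => rw [show centering n * centering n = centering n * (1 - (1 / (n : ℝ)) •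
    Matrix.of fun _ _ => 1) from rfl, Matrix.mul_sub, Matrix.mul_smul, centering_mul_ones]
  simp

/-- `centering n` is symmetric and idempotent, hence an orthogonal projection; Pythagoras splits `A`
into two orthogonal parts. -/
theorem frobNorm_centering_mul_le {n : ℕ} (A : Matrix (Fin n) (Fin n) ℝ) :
    frobNorm (centering n * A) ≤ frobNorm A := by
  refine (sq_le_sq₀ (frobNorm_nonneg _) (frobNorm_nonneg _)).1 ?_
  have h : frobNorm A ^ 2 = frobNorm (centering n * A) ^ 2 +
      frobNorm ((1 - centering n) * A) ^ 2 := by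
    simp only [frobNorm_sq_eq_trace, Matrix.transpose_mul, Matrix.transpose_sub,
      Matrix.transpose_one, centering_transpose]
    rw [← Matrix.trace_add, Matrix.mul_assoc, ← Matrix.mul_assoc (centering n) _ A,
      centering_mul_self, Matrix.mul_assoc, ← Matrix.mul_assoc (1 - centering n) _ A]
    have h1 : (1 - centering n) * (1 - centering n) = 1 - centering n := by
      simp [Matrix.mul_sub, Matrix.sub_mul, centering_mul_self]
    rw [h1, Matrix.sub_mul, Matrix.mul_sub]
    simp
  rw [h]
  linarith [sq_nonneg (frobNorm ((1 - centering n) * A))]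

theorem frobNorm_mul_centering_le {n : ℕ} (A : Matrix (Fin n) (Fin n) ℝ) :
    frobNorm (A * centering n) ≤ frobNorm A := by
  rw [← frobNorm_transpose, Matrix.transpose_mul, centering_transpose]
  exact (frobNorm_centering_mul_le _).trans_eq (frobNorm_transpose A)

theorem frobNorm_centering_mul_mul_centering_le {n : ℕ} (A : Matrix (Fin n) (Fin n) ℝ) :
    frobNorm (centering n * A * centering n) ≤ frobNorm A :=
  (frobNorm_mul_centering_le _).trans (frobNorm_centering_mul_le A)

/-! ### Low-rank approximation -/

/-- The squared lengths of the projections of the standard basis vectors add up to the dimension. -/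
theorem sum_norm_sq_orthogonalProjection_basis {n : ℕ} (K : Submodule ℝ (EuclideanSpace ℝ (Fin n))) :
    ∑ j, ‖K.starProjection (EuclideanSpace.basisFun (Fin n) ℝ j)‖ ^ 2 = Module.finrank ℝ K := by
  set b := stdOrthonormalBasis ℝ K
  set e := EuclideanSpace.basisFun (Fin n) ℝ
  -- After exchanging sums, each vector of an orthonormal basis of `K` contributes its squared norm
  -- 1.
  have h1 : ∀ j, ‖K.starProjection (e j)‖ ^ 2 = ∑ a, ‖inner ℝ (b a : EuclideanSpace ℝ (Fin n)) (e j)‖ ^ 2 := by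
    intro j
    rw [Submodule.starProjection_apply, ← Submodule.coe_norm, ← b.sum_sq_norm_inner_right]
    refine Finset.sum_congr rfl fun a _ => ?_
    rw [Submodule.inner_orthogonalProjectionOnto_eq_of_mem_left]
  simp_rw [h1]
  rw [Finset.sum_comm]
  have h2 : ∀ a, ∑ j, ‖inner ℝ (b a : EuclideanSpace ℝ (Fin n)) (e j)‖ ^ 2 = 1 := by
    intro a
    rw [e.sum_sq_norm_inner_left, ← Submodule.coe_norm, b.orthonormal.1 a, one_pow]
  rw [Finset.sum_congr rfl fun a _ => h2 a]
  simp

/-- The Frobenius distance of a diagonal matrix with decreasing non-negative entries from a matrix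
of rank at most `d` is at least that from its truncation. -/
theorem sum_sq_tail_le_frobNorm_sub_sq {n d : ℕ} (hdn : d ≤ n) {σ : Fin n → ℝ} (hσ : Antitone σ)
    (hσ0 : ∀ k, 0 ≤ σ k) (Z : Matrix (Fin n) (Fin d) ℝ) (C : Matrix (Fin d) (Fin n) ℝ) :
    ∑ k : Fin n, (if (k : ℕ) < d then 0 else σ k ^ 2) ≤
      frobNorm (Matrix.diagonal σ - Z * C) ^ 2 := by
  let z : Fin d → EuclideanSpace ℝ (Fin n) := fun l => WithLp.toLp 2 fun i => Z i l
  let K : Submodule ℝ (EuclideanSpace ℝ (Fin n)) := Submodule.span ℝ (Set.range z)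
  let e := EuclideanSpace.basisFun (Fin n) ℝ
  let p : Fin n → ℝ := fun j => ‖K.starProjection (e j)‖ ^ 2
  have hK : (Module.finrank ℝ K : ℝ) ≤ d := by
    have := finrank_range_le_card (R := ℝ) z
    simp only [Fintype.card_fin] at this
    exact_mod_cast this
  have hp0 : ∀ j, 0 ≤ p j := fun j => sq_nonneg _
  have hsplit : ∀ j, 1 - p j = ‖e j - K.starProjection (e j)‖ ^ 2 := by
    intro j
    have h := K.norm_sq_eq_add_norm_sq_starProjection (e j)
    have h1 : ‖e j‖ = 1 := e.orthonormal.1 j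
    rw [h1, Submodule.starProjection_orthogonal_val] at h
    simp only [p]
    linarith
  have hp1 : ∀ j, p j ≤ 1 := fun j => by
    have := hsplit j
    nlinarith [sq_nonneg ‖e j - K.starProjection (e j)‖]
  have hsum : ∑ j, p j ≤ d := (sum_norm_sq_orthogonalProjection_basis K).trans_le hK
  -- Column `j` is `σ j • e j` minus a vector of `K`, so its component orthogonal to `K` has squared
  -- norm `σ j ^ 2 * (1 - p j)`.
  have hcol : ∀ j, σ j ^ 2 * (1 - p j) ≤ ∑ i, (Matrix.diagonal σ - Z * C) i j ^ 2 := by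
    intro j
    let w : EuclideanSpace ℝ (Fin n) := ∑ l, C l j • z l
    have hw : w ∈ K := Submodule.sum_mem _ fun l _ =>
      K.smul_mem _ (Submodule.subset_span ⟨l, rfl⟩)
    have hwi : ∀ i, w i = ∑ l, Z i l * C l j := fun i => by simp [w, z, mul_comm]
    have hv : ∑ i, (Matrix.diagonal σ - Z * C) i j ^ 2 = ‖σ j • e j - w‖ ^ 2 := by
      rw [EuclideanSpace.norm_sq_eq]
      refine Finset.sum_congr rfl fun i _ => ?_
      rw [Real.norm_eq_abs, sq_abs, PiLp.sub_apply, hwi, Matrix.sub_apply, Matrix.mul_apply]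
      by_cases h : i = j <;> simp [h, e]
    rw [hv, K.norm_sq_eq_add_norm_sq_starProjection, Submodule.starProjection_orthogonal_val,
      map_sub, K.starProjection_eq_self_iff.2 hw, map_smul]
    have h2 : σ j • e j - w - (σ j • K.starProjection (e j) - w) =
        σ j • (e j - K.starProjection (e j)) := by
      rw [smul_sub]; abel
    rw [h2, norm_smul, mul_pow, ← hsplit, Real.norm_eq_abs, sq_abs]
    linarith [sq_nonneg ‖σ j • K.starProjection (e j) - w‖]
  have hF : ∑ j, σ j ^ 2 * (1 - p j) ≤ frobNorm (Matrix.diagonal σ - Z * C) ^ 2 := by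
    rw [frobNorm_sq, Finset.sum_comm]
    exact Finset.sum_le_sum fun j _ => hcol j
  refine le_trans ?_ hF
  -- For `d = n` the tail is empty and the pivot index `d` used below does not exist.
  rcases hdn.eq_or_lt with rfl | hlt
  · refine (Finset.sum_eq_zero fun k _ => by simp).trans_le
      (Finset.sum_nonneg fun j _ => mul_nonneg (sq_nonneg _) (by linarith [hp1 j]))
  set τ : ℝ := σ ⟨d, hlt⟩ ^ 2
  -- The weights `p k` lie in `[0, 1]` and have total at most `d`, so they save most on the `d`
  -- largest entries. Comparison with the pivot `τ` shows this termwise; the correction sums to `τ *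
  -- (d - ∑ p k) ≥ 0`.
  have hterm : ∀ k : Fin n, (if (k : ℕ) < d then 0 else σ k ^ 2) +
      τ * ((if (k : ℕ) < d then 1 else 0) - p k) ≤ σ k ^ 2 * (1 - p k) := by
    intro k
    split_ifs with h
    · have : τ ≤ σ k ^ 2 := pow_le_pow_left₀ (hσ0 _) (hσ (Fin.le_def.2 h.le)) 2
      nlinarith [hp1 k]
    · have : σ k ^ 2 ≤ τ := pow_le_pow_left₀ (hσ0 _) (hσ (Fin.le_def.2 (not_lt.1 h))) 2
      nlinarith [hp0 k]
  have hcount : ∑ k : Fin n, (if (k : ℕ) < d then (1 : ℝ) else 0) = d := by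
    rw [Finset.sum_boole]
    have : (Finset.univ.filter fun k : Fin n => (k : ℕ) < d) = Finset.Iio ⟨d, hlt⟩ := by
      ext k; simp [Fin.lt_def]
    rw [this, Fin.card_Iio]
  have hall := Finset.sum_le_sum fun k (_ : k ∈ Finset.univ) => hterm k
  rw [Finset.sum_add_distrib, ← Finset.mul_sum, Finset.sum_sub_distrib, hcount] at hall
  nlinarith [mul_nonneg (sq_nonneg (σ ⟨d, hlt⟩)) (sub_nonneg.2 hsum)]

/-! ### Absolute value and truncation of a symmetric matrix -/

open Matrix in
/-- The two polar factors of a symmetric matrix agree. -/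
theorem mul_diagonal_mul_transpose_eq_of_isSymm {n : ℕ} {U V : Matrix (Fin n) (Fin n) ℝ}
    (hU : U * Uᵀ = 1) (hV : V * Vᵀ = 1) {σ : Fin n → ℝ} (hσ0 : ∀ k, 0 ≤ σ k)
    (h : (U * diagonal σ * Vᵀ).IsSymm) :
    V * diagonal σ * Vᵀ = U * diagonal σ * Uᵀ := by
  have hU' : Uᵀ * U = 1 := mul_eq_one_comm.1 hU
  have h1 : V * diagonal σ * Uᵀ = U * diagonal σ * Vᵀ := by
    have := h.eq
    simpa [Matrix.mul_assoc] using this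
  set W := Uᵀ * V with hW
  have hWt : Wᵀ = Vᵀ * U := by simp [hW]
  have hVW : V = U * W := by rw [hW, ← Matrix.mul_assoc, hU, Matrix.one_mul]
  have hWW : W * Wᵀ = 1 := by
    rw [hWt, hW, Matrix.mul_assoc, ← Matrix.mul_assoc V, hV, Matrix.one_mul, hU']
  have hWW' : Wᵀ * W = 1 := mul_eq_one_comm.1 hWW
  have h2 : W * diagonal σ = diagonal σ * Wᵀ := by
    calc W * diagonal σ = Uᵀ * (V * diagonal σ * Uᵀ) * U := by
          simp only [hW, Matrix.mul_assoc, hU', Matrix.mul_one]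
      _ = diagonal σ * Wᵀ := by
          rw [h1, hWt]
          simp only [← Matrix.mul_assoc, hU', Matrix.one_mul]
  -- `W` commutes with `Σ²`, and therefore with `Σ`, because `σ ≥ 0` makes squaring injective on the
  -- entries.
  have h3 : diagonal σ * diagonal σ * W = W * (diagonal σ * diagonal σ) := by
    calc diagonal σ * diagonal σ * W = diagonal σ * (Wᵀ * W) * diagonal σ * W := by
          rw [hWW', Matrix.mul_one]
      _ = (diagonal σ * Wᵀ) * (W * diagonal σ) * W := by simp only [Matrix.mul_assoc]
      _ = W * diagonal σ * (diagonal σ * Wᵀ) * W := by rw [← h2]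
      _ = W * (diagonal σ * diagonal σ) * (Wᵀ * W) := by simp only [Matrix.mul_assoc]
      _ = W * (diagonal σ * diagonal σ) := by rw [hWW', Matrix.mul_one]
  have h4 : diagonal σ * W = W * diagonal σ := by
    ext i j
    have h5 := congrFun (congrFun h3 i) j
    rw [diagonal_mul_diagonal, diagonal_mul, mul_diagonal] at h5
    rw [diagonal_mul, mul_diagonal]
    have h6 : W i j * (σ i - σ j) * (σ i + σ j) = 0 := by linear_combination h5
    rcases mul_eq_zero.1 h6 with h7 | h7
    · linear_combination h7
    · have hi : σ i = 0 := by linarith [hσ0 i, hσ0 j]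
      have hj : σ j = 0 := by linarith [hσ0 i, hσ0 j]
      simp [hi, hj]
  calc V * diagonal σ * Vᵀ = U * (W * diagonal σ) * Wᵀ * Uᵀ := by
        rw [hVW, Matrix.transpose_mul]
        simp only [Matrix.mul_assoc]
    _ = U * diagonal σ * (W * Wᵀ) * Uᵀ := by rw [← h4]; simp only [Matrix.mul_assoc]
    _ = U * diagonal σ * Uᵀ := by rw [hWW, Matrix.mul_one]

open Matrix in
-- Expand `0 ≤ σ k * (A k l - B k l) ^ 2`. With `A = Uᵀ Z` and `B = Vᵀ Z` this compares the traces
-- of `Zᵀ M Z` and `Zᵀ |M| Z`.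
theorem trace_transpose_mul_diagonal_mul_le {n d : ℕ} {σ : Fin n → ℝ} (hσ0 : ∀ k, 0 ≤ σ k)
    (A B : Matrix (Fin n) (Fin d) ℝ) :
    2 * (Aᵀ * diagonal σ * B).trace ≤
      (Aᵀ * diagonal σ * A).trace + (Bᵀ * diagonal σ * B).trace := by
  have h : ∀ A B : Matrix (Fin n) (Fin d) ℝ,
      (Aᵀ * diagonal σ * B).trace = ∑ l, ∑ k, σ k * (A k l * B k l) := by
    intro A B
    simp only [trace, diag_apply, Matrix.mul_apply (M := Aᵀ * diagonal σ), mul_diagonal,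
      transpose_apply]
    exact Finset.sum_congr rfl fun l _ => Finset.sum_congr rfl fun k _ => by ring
  rw [h, h, h, Finset.mul_sum, ← Finset.sum_add_distrib]
  refine Finset.sum_le_sum fun l _ => ?_
  rw [Finset.mul_sum, ← Finset.sum_add_distrib]
  refine Finset.sum_le_sum fun k _ => ?_
  nlinarith [mul_nonneg (hσ0 k) (sq_nonneg (A k l - B k l))]

open Matrix in
/-- Replacing a symmetric matrix by its absolute value does not increase the Frobenius distance from
a positive semidefinite matrix. -/
theorem frobNorm_polar_sub_le {n d : ℕ} {U V : Matrix (Fin n) (Fin n) ℝ}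
    (hU : U * Uᵀ = 1) (hV : V * Vᵀ = 1) {σ : Fin n → ℝ} (hσ0 : ∀ k, 0 ≤ σ k)
    (h : (U * diagonal σ * Vᵀ).IsSymm) (Z : Matrix (Fin n) (Fin d) ℝ) :
    frobNorm (U * diagonal σ * Uᵀ - Z * Zᵀ) ≤ frobNorm (U * diagonal σ * Vᵀ - Z * Zᵀ) := by
  have hU' : Uᵀ * U = 1 := mul_eq_one_comm.1 hU
  have hV' : Vᵀ * V = 1 := mul_eq_one_comm.1 hV
  -- `M` and `|M|` have equal Frobenius norms, so only the cross term distinguishes the two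
  -- distances.
  have hexp : ∀ A : Matrix (Fin n) (Fin n) ℝ, A.IsSymm → frobNorm (A - Z * Zᵀ) ^ 2 =
      frobNorm A ^ 2 - 2 * (Zᵀ * A * Z).trace + frobNorm (Z * Zᵀ) ^ 2 := by
    intro A hA
    have h1 : (A * (Z * Zᵀ)).trace = (Zᵀ * A * Z).trace := by
      rw [← Matrix.mul_assoc, trace_mul_comm, Matrix.mul_assoc]
    have h2 : (Z * Zᵀ * A).trace = (Zᵀ * A * Z).trace := by
      rw [Matrix.mul_assoc, trace_mul_comm]
    simp only [frobNorm_sq_eq_trace, transpose_sub, hA.eq, transpose_mul, transpose_transpose,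
      Matrix.sub_mul, Matrix.mul_sub, trace_sub, h1, h2]
    ring
  have hpol := mul_diagonal_mul_transpose_eq_of_isSymm hU hV hσ0 h
  have hP : (U * diagonal σ * Uᵀ).IsSymm := by
    simp [IsSymm, Matrix.mul_assoc]
  have hn : frobNorm (U * diagonal σ * Uᵀ) = frobNorm (U * diagonal σ * Vᵀ) := by
    rw [frobNorm_mul_right_of_orthogonal (U := Uᵀ) (by simpa using hU'),
      frobNorm_mul_right_of_orthogonal (U := Vᵀ) (by simpa using hV')]
  have hkey := trace_transpose_mul_diagonal_mul_le hσ0 (Uᵀ * Z) (Vᵀ * Z)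
  have ha : ∀ A B : Matrix (Fin n) (Fin n) ℝ, (Aᵀ * Z)ᵀ * diagonal σ * (Bᵀ * Z) =
      Zᵀ * (A * diagonal σ * Bᵀ) * Z := by
    intro A B
    simp [Matrix.mul_assoc]
  rw [ha, ha, ha, hpol] at hkey
  refine (sq_le_sq₀ (frobNorm_nonneg _) (frobNorm_nonneg _)).1 ?_
  rw [hexp _ hP, hexp _ h, hn]
  linarith

open Matrix in
/-- The truncation of the polar factor is a quasi-optimal approximation of a positive semidefinite
matrix of rank at most `d`. -/
theorem frobNorm_truncation_sub_le {n d : ℕ} (hdn : d ≤ n) {U V : Matrix (Fin n) (Fin n) ℝ}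
    (hU : U * Uᵀ = 1) (hV : V * Vᵀ = 1) {σ : Fin n → ℝ} (hσ : Antitone σ) (hσ0 : ∀ k, 0 ≤ σ k)
    (h : (U * diagonal σ * Vᵀ).IsSymm) (Z : Matrix (Fin n) (Fin d) ℝ) :
    frobNorm (U * diagonal (fun k : Fin n => if (k : ℕ) < d then σ k else 0) * Uᵀ - Z * Zᵀ) ≤
      2 * frobNorm (U * diagonal σ * Vᵀ - Z * Zᵀ) := by
  have hU' : Uᵀ * U = 1 := mul_eq_one_comm.1 hU
  set τ : Fin n → ℝ := fun k : Fin n => if (k : ℕ) < d then σ k else 0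
  have hconj : ∀ A : Matrix (Fin n) (Fin n) ℝ, frobNorm (U * A * Uᵀ) = frobNorm A := fun A => by
    rw [frobNorm_mul_right_of_orthogonal (by simpa using hU'), frobNorm_mul_left_of_orthogonal hU']
  -- Conjugation by `U` reduces this to the diagonal case, where `Uᵀ Z Zᵀ U` is a competitor of rank
  -- at most `d`.
  have h1 : frobNorm (U * diagonal τ * Uᵀ - U * diagonal σ * Uᵀ) ≤
      frobNorm (U * diagonal σ * Uᵀ - Z * Zᵀ) := by
    have e1 : U * diagonal τ * Uᵀ - U * diagonal σ * Uᵀ = U * (diagonal τ - diagonal σ) * Uᵀ := by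
      rw [Matrix.mul_sub, Matrix.sub_mul]
    have e2 : U * diagonal σ * Uᵀ - Z * Zᵀ =
        U * (diagonal σ - (Uᵀ * Z) * (Zᵀ * U)) * Uᵀ := by
      have e3 : U * (Uᵀ * Z * (Zᵀ * U)) * Uᵀ = Z * Zᵀ := by
        calc U * (Uᵀ * Z * (Zᵀ * U)) * Uᵀ = (U * Uᵀ) * Z * Zᵀ * (U * Uᵀ) := by
              simp only [Matrix.mul_assoc]
          _ = Z * Zᵀ := by rw [hU, Matrix.one_mul, Matrix.mul_one]
      rw [Matrix.mul_sub, Matrix.sub_mul, e3]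
    rw [e1, e2, hconj, hconj]
    refine (sq_le_sq₀ (frobNorm_nonneg _) (frobNorm_nonneg _)).1 ?_
    refine le_trans (le_of_eq ?_) (sum_sq_tail_le_frobNorm_sub_sq hdn hσ hσ0 _ _)
    rw [diagonal_sub, frobNorm_sq]
    refine Finset.sum_congr rfl fun k _ => ?_
    rw [Finset.sum_eq_single k]
    · simp only [diagonal_apply_eq, τ]
      split_ifs <;> ring
    · intro b _ hb
      simp [diagonal_apply_ne' _ hb]
    · simp
  have h2 := frobNorm_polar_sub_le hU hV hσ0 h Z
  have h3 := frobNorm_add_le (U * diagonal τ * Uᵀ - U * diagonal σ * Uᵀ)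
    (U * diagonal σ * Uᵀ - Z * Zᵀ)
  rw [sub_add_sub_cancel] at h3
  linarith

/-! ### Stability of multidimensional scaling -/

/-- The matrix of squared distances of the rows of `X`. -/
def sqDistMatrix {n d : ℕ} (X : Matrix (Fin n) (Fin d) ℝ) : Matrix (Fin n) (Fin n) ℝ :=
  Matrix.of fun i j => ∑ k, (X i k - X j k) ^ 2

open Matrix in
-- With `v i` the squared norm of row `i`, the squared distances are `v 1ᵀ + 1 vᵀ - 2 X Xᵀ`, and
-- centering annihilates the constant vector.
theorem centering_sqDistMatrix {n d : ℕ} (X : Matrix (Fin n) (Fin d) ℝ) :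
    (-(1 / 2) : ℝ) • (centering n * sqDistMatrix X * centering n) =
      (centering n * X) * (centering n * X)ᵀ := by
  set J : Matrix (Fin n) (Fin n) ℝ := Matrix.of fun _ _ => 1
  set v : Fin n → ℝ := fun i => ∑ k, X i k ^ 2
  have hJ : centering n * J = 0 := centering_mul_ones n
  have hJ' : J * centering n = 0 := by
    have := congrArg transpose hJ
    rwa [transpose_mul, centering_transpose, transpose_zero, show Jᵀ = J from rfl] at this
  have hD : sqDistMatrix X = diagonal v * J + J * diagonal v - (2 : ℝ) • (X * Xᵀ) := by
    ext i j
    rw [Matrix.sub_apply, Matrix.add_apply, diagonal_mul, mul_diagonal, Matrix.smul_apply,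
      Matrix.mul_apply]
    simp only [sqDistMatrix, of_apply, transpose_apply, J, v, smul_eq_mul, mul_one, one_mul,
      Finset.mul_sum]
    rw [← Finset.sum_add_distrib, ← Finset.sum_sub_distrib]
    exact Finset.sum_congr rfl fun k _ => by ring
  have h1 : centering n * (diagonal v * J) * centering n = 0 := by
    rw [Matrix.mul_assoc, Matrix.mul_assoc, hJ', Matrix.mul_zero, Matrix.mul_zero]
  have h2 : centering n * (J * diagonal v) * centering n = 0 := by
    rw [← Matrix.mul_assoc, hJ, Matrix.zero_mul, Matrix.zero_mul]
  rw [hD, Matrix.mul_sub, Matrix.sub_mul, Matrix.mul_add, Matrix.add_mul, h1, h2, Matrix.mul_smul,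
    Matrix.smul_mul, zero_add, zero_sub, smul_neg, smul_smul, transpose_mul, centering_transpose]
  norm_num [Matrix.mul_assoc]

open Matrix in
/-- Stability of classical multidimensional scaling. -/
theorem IsMDS.dInv_le {n d : ℕ} {D : Matrix (Fin n) (Fin n) ℝ} (hD : D.IsSymm)
    {Y : Matrix (Fin n) (Fin d) ℝ} (hY : IsMDS D Y) (X : Matrix (Fin n) (Fin d) ℝ) :
    dInv X Y ≤ 1 / (n : ℝ) * frobNorm (D - sqDistMatrix X) := by
  obtain ⟨hdn, U, hU, V, hV, σ, hσ, hσ0, hUV, rfl⟩ := hY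
  rw [mem_orthogonalGroup_iff] at hU hV
  replace hU : U * Uᵀ = 1 := hU
  replace hV : V * Vᵀ = 1 := hV
  set Y : Matrix (Fin n) (Fin d) ℝ :=
    Matrix.of fun i k => U i (Fin.castLE hdn k) * Real.sqrt (σ (Fin.castLE hdn k))
  set Z := centering n * X
  have hYY : Y * Yᵀ = U * diagonal (fun k : Fin n => if (k : ℕ) < d then σ k else 0) * Uᵀ := by
    ext i j
    rw [Matrix.mul_apply, Matrix.mul_apply]
    simp only [mul_diagonal, transpose_apply, Y, of_apply]
    obtain ⟨m, rfl⟩ := Nat.exists_eq_add_of_le hdn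
    rw [Fin.sum_univ_add]
    have hz : ∑ l : Fin m, U i (Fin.natAdd d l) *
        (if ((Fin.natAdd d l : Fin (d + m)) : ℕ) < d then σ (Fin.natAdd d l) else 0) *
          U j (Fin.natAdd d l) = 0 :=
      Finset.sum_eq_zero fun l _ => by simp
    rw [hz, add_zero]
    refine Finset.sum_congr rfl fun k _ => ?_
    have := Real.mul_self_sqrt (hσ0 (Fin.castAdd m k))
    simp only [Fin.val_castAdd, k.is_lt, if_true]
    change U i (Fin.castAdd m k) * √(σ (Fin.castAdd m k)) *
      (U j (Fin.castAdd m k) * √(σ (Fin.castAdd m k))) = _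
    linear_combination (U i (Fin.castAdd m k) * U j (Fin.castAdd m k)) * this
  have hsymm : (U * diagonal σ * Vᵀ).IsSymm := by
    rw [← hUV]
    simp [IsSymm, centering_transpose, hD.eq, Matrix.mul_assoc]
  have h1 := frobNorm_truncation_sub_le hdn hU hV hσ hσ0 hsymm Z
  rw [← hYY, ← hUV, ← centering_sqDistMatrix, ← smul_sub, ← Matrix.sub_mul, ← Matrix.mul_sub,
    frobNorm_smul, centering_sqDistMatrix] at h1
  have h2 := frobNorm_centering_mul_mul_centering_le (D - sqDistMatrix X)
  have h3 := frobNorm_centering_mul_mul_centering_le (Y * Yᵀ - Z * Zᵀ)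
  have h4 : centering n * X * Xᵀ * centering n - centering n * Y * Yᵀ * centering n =
      -- `Y` need not be centered, but `Z` is; the outer projections only decrease the norm.
      -(centering n * (Y * Yᵀ - Z * Zᵀ) * centering n) := by
    have h5 : centering n * (Z * Zᵀ) * centering n = centering n * X * Xᵀ * centering n := by
      simp only [Z, transpose_mul, centering_transpose]
      calc centering n * (centering n * X * (Xᵀ * centering n)) * centering n =
          (centering n * centering n) * X * Xᵀ * (centering n * centering n) := by
            simp only [Matrix.mul_assoc]
        _ = _ := by rw [centering_mul_self]
    rw [Matrix.mul_sub, Matrix.sub_mul, h5, neg_sub]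
    simp only [Matrix.mul_assoc]
  rw [dInv, h4, frobNorm_neg]
  refine mul_le_mul_of_nonneg_left ?_ (by positivity)
  change frobNorm (Y * Yᵀ - Z * Zᵀ) ≤ _ at h1
  rw [abs_neg, abs_of_pos one_half_pos] at h1
  linarith

/-! ### Hop counts and distances -/

/-- Greedy routing: if far targets can be approached by one edge and near ones reached by two edges,
then shortest paths are almost straight. -/
theorem exists_walk_of_greedy {V E : Type*} [PseudoMetricSpace E] {x : V → E} {G : SimpleGraph V}
    {R ρ : ℝ} (hρ : 0 < ρ)
    (hfar : ∀ i j, R < dist (x i) (x j) →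
      ∃ k, G.Adj i k ∧ dist (x k) (x j) ≤ dist (x i) (x j) - ρ)
    (hnear : ∀ i j, i ≠ j → dist (x i) (x j) ≤ R → ∃ k, G.Adj i k ∧ G.Adj k j) (i j : V) :
    ∃ w : G.Walk i j, ((w.length : ℝ) - 2) * ρ ≤ dist (x i) (x j) := by
  -- `N` bounds the number of greedy steps. At `N = 0` a far step would make a distance negative.
  obtain ⟨N, hN⟩ := exists_nat_ge (dist (x i) (x j) / ρ)
  rw [div_le_iff₀ hρ] at hN
  induction N generalizing i with
  | zero =>
    by_cases hij : i = j
    · subst hij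
      exact ⟨.nil, by simp; linarith⟩
    rcases le_or_gt (dist (x i) (x j)) R with h | h
    · obtain ⟨k, hik, hkj⟩ := hnear i j hij h
      exact ⟨.cons hik (.cons hkj .nil), by simp⟩
    · obtain ⟨k, -, hk⟩ := hfar i j h
      have : 0 ≤ dist (x k) (x j) := dist_nonneg
      push_cast at hN
      linarith
  | succ N ih =>
    by_cases hij : i = j
    · subst hij
      exact ⟨.nil, by simp; linarith⟩
    rcases le_or_gt (dist (x i) (x j)) R with h | h
    · obtain ⟨k, hik, hkj⟩ := hnear i j hij h
      exact ⟨.cons hik (.cons hkj .nil), by simp⟩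
    · obtain ⟨k, hik, hk⟩ := hfar i j h
      obtain ⟨w, hw⟩ := ih k (by push_cast at hN; linarith)
      refine ⟨.cons hik w, ?_⟩
      rw [SimpleGraph.Walk.length_cons]
      push_cast
      linarith

theorem dist_le_mul_walk_length {V E : Type*} [PseudoMetricSpace E] {x : V → E}
    {G : SimpleGraph V} {R : ℝ} (hadj : ∀ i j, G.Adj i j → dist (x i) (x j) ≤ R) {i j : V}
    (w : G.Walk i j) : dist (x i) (x j) ≤ R * w.length := by
  induction w with
  | nil => simp
  | @cons i k j h w ih =>
    rw [SimpleGraph.Walk.length_cons]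
    push_cast
    linarith [dist_triangle (x i) (x k) (x j), hadj _ _ h]

/-- With `r = 32 s / R < 1` the progress per hop is `R (1 - r / 8)`, and `1 / (1 - r / 8) ≤ 1 + r /
7`, so `R h ≤ 2 R + D (1 + r / 7)`. Squaring, `D ≤ 7 / 4` bounds the terms with a factor `R` by `4
R² + 8 R ≤ 12 R`, and `D² ≤ 3` bounds the rest by `(45 / 49) r`. -/
theorem abs_sq_hops_sub_sq_dist_le {R s D h : ℝ} (hR1 : R ≤ 1) (hs : 0 < s)
    (hsR : 32 * s < R) (hD : 0 ≤ D) (hD3 : D ^ 2 ≤ 3) (hlow : D ≤ R * h)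
    (hup : (h - 2) * (R - 4 * s) ≤ D) :
    |(R * h) ^ 2 - D ^ 2| ≤ 32 * s / R + 20 * R := by
  have hR : 0 < R := by linarith
  set r := 32 * s / R with hr
  have hr0 : 0 < r := by positivity
  have hr1 : r < 1 := by rw [hr, div_lt_one hR]; exact hsR
  have hsr : 4 * s = r / 8 * R := by rw [hr]; field_simp; norm_num
  have hD2 : D ≤ 7 / 4 := by nlinarith
  have h1 : R * h ≤ 2 * R + D * (1 + r / 7) := by
    have h2 : (R * h - 2 * R) * (1 - r / 8) ≤ D := by
      rw [hsr] at hup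
      linarith
    have h3 : D ≤ D * (1 + r / 7) * (1 - r / 8) := by
      have : D * (1 + r / 7) * (1 - r / 8) - D = D * r * (1 - r) / 56 := by ring
      nlinarith [mul_nonneg (mul_nonneg hD hr0.le) (sub_nonneg.2 hr1.le)]
    have h4 : 0 < 1 - r / 8 := by linarith
    have h5 := le_of_mul_le_mul_right (h2.trans h3) h4
    linarith
  have h6 : 0 ≤ (R * h) ^ 2 - D ^ 2 := by nlinarith
  rw [abs_of_nonneg h6]
  have h7 : (R * h) ^ 2 ≤ (2 * R + D * (1 + r / 7)) ^ 2 := pow_le_pow_left₀ (hD.trans hlow) h1 2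
  have h8 : (2 * R + D * (1 + r / 7)) ^ 2 - D ^ 2 =
      4 * R * R + 4 * R * (D * (1 + r / 7)) + D ^ 2 * (2 * r / 7 + r * r / 49) := by ring
  have h9 : D * (1 + r / 7) ≤ 2 := by nlinarith
  have h10 : D ^ 2 * (2 * r / 7 + r * r / 49) ≤ 3 * (2 * r / 7 + r * r / 49) :=
    mul_le_mul_of_nonneg_right hD3 (by positivity)
  nlinarith [mul_le_mul_of_nonneg_left h9 hR.le, mul_le_mul_of_nonneg_left hR1 hR.le,
    mul_le_mul_of_nonneg_left hr1.le hr0.le]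

theorem dist_sq_le_of_mem_unitCube {d : ℕ} {x y : EuclideanSpace ℝ (Fin d)} (hx : x ∈ unitCube d)
    (hy : y ∈ unitCube d) : dist x y ^ 2 ≤ d := by
  rw [EuclideanSpace.dist_sq_eq]
  calc ∑ i, dist (x i) (y i) ^ 2 ≤ ∑ _i : Fin d, (1 : ℝ) := by
        refine Finset.sum_le_sum fun i _ => ?_
        have h := Real.dist_le_of_mem_Icc_01 (hx i) (hy i)
        exact pow_le_one₀ dist_nonneg h
    _ = d := by simp

/-- The deterministic part: a network with the greedy routing property is connected, and MDS-MAP is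
accurate on it. -/
theorem connected_and_dInv_le_of_greedy {n d : ℕ} (hn : 0 < n) (hd : d ≤ 3) {α β R s : ℝ}
    (hR1 : R ≤ 1) (hs : 0 < s) (hsR : 32 * s < R) {ω : NetworkOutcome n d}
    (hcube : ∀ i, ω.1 i ∈ unitCube d)
    (hfar : ∀ i j, R < dist (ω.1 i) (ω.1 j) → ∃ k, (connectivityGraph α β R ω).Adj i k ∧
      dist (ω.1 k) (ω.1 j) ≤ dist (ω.1 i) (ω.1 j) - (R - 4 * s))
    (hnear : ∀ i j, i ≠ j → dist (ω.1 i) (ω.1 j) ≤ R →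
      ∃ k, (connectivityGraph α β R ω).Adj i k ∧ (connectivityGraph α β R ω).Adj k j) :
    (connectivityGraph α β R ω).Connected ∧
      ∀ Y : Matrix (Fin n) (Fin d) ℝ, IsMDSMAP R (connectivityGraph α β R ω) Y →
        dInv (positionMatrix ω) Y ≤ 32 * s / R + 20 * R := by
  set G := connectivityGraph α β R ω
  have hwalk := exists_walk_of_greedy (by linarith) hfar hnear
  have : Nonempty (Fin n) := ⟨⟨0, hn⟩⟩
  have hconn : G.Connected := ⟨fun i j => ⟨(hwalk i j).choose⟩⟩
  refine ⟨hconn, fun Y hY => ?_⟩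
  have hsymm : (squaredShortestPaths R G).IsSymm := by
    ext i j
    simp [squaredShortestPaths, SimpleGraph.dist_comm]
  have hbound : ∀ i j,
      |(squaredShortestPaths R G - sqDistMatrix (positionMatrix ω)) i j| ≤ 32 * s / R + 20 * R := by
    intro i j
    have h1 : sqDistMatrix (positionMatrix ω) i j = dist (ω.1 i) (ω.1 j) ^ 2 := by
      rw [EuclideanSpace.dist_sq_eq]
      simp [sqDistMatrix, positionMatrix, Real.dist_eq]
    rw [Matrix.sub_apply, h1]
    refine abs_sq_hops_sub_sq_dist_le hR1 hs hsR dist_nonneg ?_ ?_ ?_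
    · refine (dist_sq_le_of_mem_unitCube (hcube i) (hcube j)).trans ?_
      exact_mod_cast hd
    · obtain ⟨w, hw⟩ := hconn.exists_walk_length_eq_dist i j
      rw [← hw]
      exact dist_le_mul_walk_length (x := ω.1) (G := G) (fun _ _ h => h.2.1) w
    · obtain ⟨w, hw⟩ := hwalk i j
      refine le_trans (mul_le_mul_of_nonneg_right ?_ (by linarith)) hw
      have : (G.dist i j : ℝ) ≤ w.length := by exact_mod_cast SimpleGraph.dist_le w
      linarith
  have hn' : (0 : ℝ) < n := by exact_mod_cast hn
  calc dInv (positionMatrix ω) Y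
      ≤ 1 / (n : ℝ) * frobNorm (squaredShortestPaths R G - sqDistMatrix (positionMatrix ω)) :=
        IsMDS.dInv_le hsymm hY _
    _ ≤ 1 / (n : ℝ) * (n * (32 * s / R + 20 * R)) := by
        refine mul_le_mul_of_nonneg_left (frobNorm_le_of_forall_abs_le ?_ hbound) (by positivity)
        have : 0 < R := by linarith
        positivity
    _ = 32 * s / R + 20 * R := by field_simp

/-! ### Independence of candidate relays -/

open ProbabilityTheory in
/-- The pairs `(m s(i,k), m s(j,k))` of marks are independent for distinct `k`. -/
theorem pi_forall_not_marks {n : ℕ} {ν : Measure ℝ} [IsProbabilityMeasure ν] {i j : Fin n}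
    (hij : i ≠ j) {T₁ T₂ : Set ℝ} (hT₁ : MeasurableSet T₁) (hT₂ : MeasurableSet T₂)
    (c : Fin n → Prop) [DecidablePred c] (K : Finset (Fin n)) (hK : ∀ k ∈ K, k ≠ i ∧ k ≠ j) :
    (Measure.pi fun _ : Sym2 (Fin n) => ν)
      {m | ∀ k ∈ K, ¬(c k ∧ m s(i, k) ∈ T₁ ∧ m s(j, k) ∈ T₂)} =
      ∏ k ∈ K, (1 - if c k then ν T₁ * ν T₂ else 0) := by
  set P := Measure.pi fun _ : Sym2 (Fin n) => ν
  let ms : Sym2 (Fin n) → MeasurableSpace (Sym2 (Fin n) → ℝ) :=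
    fun e => MeasurableSpace.comap (fun m => m e) inferInstance
  have hind : iIndepFun (fun (e : Sym2 (Fin n)) (m : Sym2 (Fin n) → ℝ) => m e) P :=
    iIndepFun_pi (X := fun _ => id) fun _ => aemeasurable_id
  have hle : ∀ e, ms e ≤ MeasurableSpace.pi := fun e => (measurable_pi_apply e).comap_le
  have hcoord : ∀ (S : Set (Sym2 (Fin n))) e, e ∈ S → ∀ T : Set ℝ, MeasurableSet T →
      MeasurableSet[⨆ e ∈ S, ms e] {m : Sym2 (Fin n) → ℝ | m e ∈ T} := fun S e he T hT =>
    (le_iSup₂ (f := fun e (_ : e ∈ S) => ms e) e he) _ ⟨T, hT, rfl⟩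
  have hblock : ∀ (S : Set (Sym2 (Fin n))) k, s(i, k) ∈ S → s(j, k) ∈ S →
      MeasurableSet[⨆ e ∈ S, ms e]
        {m : Sym2 (Fin n) → ℝ | ¬(c k ∧ m s(i, k) ∈ T₁ ∧ m s(j, k) ∈ T₂)} := by
    intro S k h1 h2
    by_cases hc : c k
    · simp only [hc, true_and]
      exact ((hcoord S _ h1 T₁ hT₁).inter (hcoord S _ h2 T₂ hT₂)).compl
    · simp [hc]
  have hsingle : ∀ k, k ≠ i → k ≠ j →
      P {m | ¬(c k ∧ m s(i, k) ∈ T₁ ∧ m s(j, k) ∈ T₂)} =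
        1 - if c k then ν T₁ * ν T₂ else 0 := by
    intro k hki hkj
    by_cases hc : c k
    · simp only [hc, true_and, if_true]
      have hne : s(i, k) ≠ s(j, k) := by
        simp [hij, hki.symm]
      have hinter := (hind.indepFun hne).measure_inter_preimage_eq_mul _ _ hT₁ hT₂
      have he : ∀ (e : Sym2 (Fin n)) (T : Set ℝ), MeasurableSet T →
          P ((fun m : Sym2 (Fin n) → ℝ => m e) ⁻¹' T) = ν T := fun e T hT =>
        (measurePreserving_eval (fun _ : Sym2 (Fin n) => ν) e).measure_preimage hT.nullMeasurableSet
      rw [he _ _ hT₁, he _ _ hT₂] at hinter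
      rw [← hinter, ← prob_compl_eq_one_sub]
      · rfl
      · have he' : ∀ e, Measurable fun m : Sym2 (Fin n) → ℝ => m e := by fun_prop
        exact (he' _ hT₁).inter (he' _ hT₂)
    · simp [hc]
  induction K using Finset.induction_on with
  | empty => simp
  | insert k K hk ih =>
    have hK' : ∀ l ∈ K, l ≠ i ∧ l ≠ j := fun l hl => hK l (Finset.mem_insert_of_mem hl)
    obtain ⟨hki, hkj⟩ := hK k (Finset.mem_insert_self _ _)
    -- The pairs joining `k` to `i, j` are disjoint from those of the other candidates, so they
    -- generate independent σ-algebras.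
    let S₁ : Set (Sym2 (Fin n)) := {s(i, k), s(j, k)}
    let S₂ : Set (Sym2 (Fin n)) := {e | ∃ l ∈ K, e = s(i, l) ∨ e = s(j, l)}
    have hdisj : Disjoint S₁ S₂ := by
      rw [Set.disjoint_left]
      rintro e he ⟨l, hl, he'⟩
      have hlk : l ≠ k := fun h => hk (h ▸ hl)
      obtain ⟨hli, hlj⟩ := hK' l hl
      rcases he with rfl | he <;> rcases he' with he' | he' <;>
        simp_all
    have hI := indep_iSup_of_disjoint hle hind hdisj
    rw [Finset.prod_insert hk, ← ih hK', ← hsingle k hki hkj]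
    have hset : {m : Sym2 (Fin n) → ℝ |
          ∀ l ∈ insert k K, ¬(c l ∧ m s(i, l) ∈ T₁ ∧ m s(j, l) ∈ T₂)} =
        {m | ¬(c k ∧ m s(i, k) ∈ T₁ ∧ m s(j, k) ∈ T₂)} ∩
          {m | ∀ l ∈ K, ¬(c l ∧ m s(i, l) ∈ T₁ ∧ m s(j, l) ∈ T₂)} := by
      ext m
      simp only [Finset.forall_mem_insert]
      rfl
    rw [hset]
    refine (Indep_iff _ _ _).1 hI _ _ (hblock S₁ k (by simp [S₁]) (by simp [S₁])) ?_
    have hset2 : {m : Sym2 (Fin n) → ℝ | ∀ l ∈ K, ¬(c l ∧ m s(i, l) ∈ T₁ ∧ m s(j, l) ∈ T₂)} =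
        ⋂ l ∈ K, {m | ¬(c l ∧ m s(i, l) ∈ T₁ ∧ m s(j, l) ∈ T₂)} := by
      ext m
      simp only [Set.mem_iInter]
      rfl
    rw [hset2]
    exact @Finset.measurableSet_biInter _ _ (⨆ e ∈ S₂, ms e) _ K fun l hl =>
      hblock S₂ l ⟨l, hl, Or.inl rfl⟩ ⟨l, hl, Or.inr rfl⟩

open ProbabilityTheory in
/-- Integrating out all coordinates but two. -/
theorem lintegral_pi_prod_le {n : ℕ} {E : Type*} [MeasurableSpace E] {μ : Measure E}
    [IsProbabilityMeasure μ] {i j : Fin n} (hij : i ≠ j) {g : E × E × E → ENNReal}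
    (hg : Measurable g) {Q : Set E} (hQ : ∀ᵐ x ∂μ, x ∈ Q) {b : ENNReal}
    (hb : ∀ x ∈ Q, ∀ y ∈ Q, ∫⁻ z, g (x, y, z) ∂μ ≤ b) :
    ∫⁻ x, ∏ k with k ≠ i ∧ k ≠ j, g (x i, x j, x k) ∂(Measure.pi fun _ : Fin n => μ) ≤
      b ^ (n - 2) := by
  let p : Fin n → Prop := fun k => k = i ∨ k = j
  have hmp := measurePreserving_piEquivPiSubtypeProd (fun _ : Fin n => μ) p
  let i' : {k // p k} := ⟨i, Or.inl rfl⟩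
  let j' : {k // p k} := ⟨j, Or.inr rfl⟩
  let f : ({k // p k} → E) × ({k // ¬p k} → E) → ENNReal :=
    fun yw => ∏ k, g (yw.1 i', yw.1 j', yw.2 k)
  have hf : Measurable f := by
    refine Finset.measurable_prod _ fun k _ => hg.comp ?_
    fun_prop
  have hcard : Fintype.card {k // ¬p k} = n - 2 := by
    rw [Fintype.card_subtype_compl, Fintype.card_fin, Fintype.card_subtype]
    congr 1
    have : (Finset.univ.filter p) = {i, j} := by
      ext k; simp [p]
    rw [this, Finset.card_pair hij]
  have heq : ∀ x : Fin n → E, ∏ k with k ≠ i ∧ k ≠ j, g (x i, x j, x k) =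
      f (MeasurableEquiv.piEquivPiSubtypeProd (fun _ => E) p x) := by
    intro x
    refine Finset.prod_subtype _ (fun k => ?_) fun k => g (x i, x j, x k)
    simp [p]
  simp_rw [heq]
  rw [hmp.lintegral_comp hf, lintegral_prod _ hf.aemeasurable]
  have hae : ∀ a : {k // p k}, ∀ᵐ y ∂(Measure.pi fun _ : {k // p k} => μ), y a ∈ Q := fun a =>
    (Measure.quasiMeasurePreserving_eval (fun _ : {k // p k} => μ) a).ae hQ
  calc ∫⁻ y, ∫⁻ w, f (y, w) ∂(Measure.pi fun _ : {k // ¬p k} => μ)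
        ∂(Measure.pi fun _ : {k // p k} => μ)
      ≤ ∫⁻ _y, b ^ (n - 2) ∂(Measure.pi fun _ : {k // p k} => μ) := by
        refine lintegral_mono_ae ?_
        filter_upwards [hae i', hae j'] with y hi hj
        have hgy : Measurable fun z => g (y i', y j', z) := hg.comp (by fun_prop)
        have hind : iIndepFun (fun (k : {k // ¬p k}) (w : {k // ¬p k} → E) =>
            g (y i', y j', w k)) (Measure.pi fun _ => μ) :=
          iIndepFun_pi (X := fun _ z => g (y i', y j', z)) fun _ => hgy.aemeasurable
        have h1 := lintegral_prod_eq_prod_lintegral_of_indepFun Finset.univ _ hind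
          fun k => hgy.comp (measurable_pi_apply k)
        refine h1.trans_le ?_
        rw [← hcard, ← Finset.card_univ, ← Finset.prod_const]
        refine Finset.prod_le_prod' fun k _ => ?_
        rw [(measurePreserving_eval (fun _ : {k // ¬p k} => μ) k).lintegral_comp hgy]
        exact hb _ hi _ hj
    _ = b ^ (n - 2) := by simp

/-- The probability that no node `k` is a relay for the pair `i, j`. -/
theorem prod_pi_forall_not_relay_le {n : ℕ} {E : Type*} [MeasurableSpace E] {μ : Measure E}
    [IsProbabilityMeasure μ] {ν : Measure ℝ} [IsProbabilityMeasure ν] {i j : Fin n} (hij : i ≠ j)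
    {B : Set (E × E × E)} (hB : MeasurableSet B) {T₁ T₂ : Set ℝ} (hT₁ : MeasurableSet T₁)
    (hT₂ : MeasurableSet T₂) {Q : Set E} (hQ : ∀ᵐ x ∂μ, x ∈ Q) {v : ENNReal}
    (hv : ∀ x ∈ Q, ∀ y ∈ Q, v ≤ μ {z | (x, y, z) ∈ B}) :
    ((Measure.pi fun _ : Fin n => μ).prod (Measure.pi fun _ : Sym2 (Fin n) => ν))
      {ω | ∀ k, k ≠ i → k ≠ j →
        ¬((ω.1 i, ω.1 j, ω.1 k) ∈ B ∧ ω.2 s(i, k) ∈ T₁ ∧ ω.2 s(j, k) ∈ T₂)} ≤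
      (1 - ν T₁ * ν T₂ * v) ^ (n - 2) := by
  classical
  set t := ν T₁ * ν T₂
  have ht : t ≤ 1 := mul_le_one' prob_le_one prob_le_one
  have hmeas : MeasurableSet {ω : (Fin n → E) × (Sym2 (Fin n) → ℝ) | ∀ k, k ≠ i → k ≠ j →
      ¬((ω.1 i, ω.1 j, ω.1 k) ∈ B ∧ ω.2 s(i, k) ∈ T₁ ∧ ω.2 s(j, k) ∈ T₂)} := by
    simp only [Set.ofPred_forall]
    refine MeasurableSet.iInter fun k => MeasurableSet.iInter fun _ => MeasurableSet.iInter fun _ => ?_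
    have h1 : Measurable fun ω : (Fin n → E) × (Sym2 (Fin n) → ℝ) =>
      (ω.1 i, ω.1 j, ω.1 k) := by fun_prop
    have h2 : ∀ e, Measurable fun ω : (Fin n → E) × (Sym2 (Fin n) → ℝ) => ω.2 e := by fun_prop
    exact ((h1 hB).inter ((h2 _ hT₁).inter (h2 _ hT₂))).compl
  rw [Measure.prod_apply hmeas]
  -- Given the positions, `g` is the probability over the marks that a candidate fails.
  let g : E × E × E → ENNReal := fun q => 1 - B.indicator (fun _ => t) q
  have hg : Measurable g := measurable_const.sub (measurable_const.indicator hB)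
  have hslice : ∀ x : Fin n → E, (Measure.pi fun _ : Sym2 (Fin n) => ν)
      (Prod.mk x ⁻¹' {ω : (Fin n → E) × (Sym2 (Fin n) → ℝ) | ∀ k, k ≠ i → k ≠ j →
        ¬((ω.1 i, ω.1 j, ω.1 k) ∈ B ∧ ω.2 s(i, k) ∈ T₁ ∧ ω.2 s(j, k) ∈ T₂)}) =
      ∏ k with k ≠ i ∧ k ≠ j, g (x i, x j, x k) := by
    intro x
    have h := pi_forall_not_marks (ν := ν) hij hT₁ hT₂ (fun k => (x i, x j, x k) ∈ B)
      (Finset.univ.filter fun k => k ≠ i ∧ k ≠ j) (fun k hk => by simpa using hk)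
    simp only [Finset.mem_filter, Finset.mem_univ, true_and, and_imp] at h
    exact h
  simp_rw [hslice]
  refine lintegral_pi_prod_le hij hg hQ fun x hx y hy => ?_
  have hBxy : MeasurableSet {z | (x, y, z) ∈ B} :=
    (measurable_const.prodMk (measurable_const.prodMk measurable_id)) hB
  have h1 : ∫⁻ z, g (x, y, z) ∂μ = 1 - t * μ {z | (x, y, z) ∈ B} := by
    have h2 : ∀ z, g (x, y, z) = 1 - {z | (x, y, z) ∈ B}.indicator (fun _ => t) z := fun z => rfl
    simp_rw [h2]
    rw [lintegral_sub (measurable_const.indicator hBxy), lintegral_indicator_const hBxy]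
    · simp
    · rw [lintegral_indicator_const hBxy]
      exact (ENNReal.mul_lt_top (ht.trans_lt ENNReal.one_lt_top) (measure_lt_top _ _)).ne
    · refine Filter.Eventually.of_forall fun z => ?_
      exact Set.indicator_le_self' (fun _ _ => zero_le) z |>.trans ht
  rw [h1]
  exact tsub_le_tsub_left (mul_le_mul_right (hv x hx y hy) t) 1

/-! ### Volume of the relay regions -/

theorem convex_unitCube (d : ℕ) : Convex ℝ (unitCube d) := by
  intro x hx y hy a b ha hb hab k
  exact (convex_Icc (0 : ℝ) 1) (hx k) (hy k) ha hb hab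

theorem measurableSet_unitCube (d : ℕ) : MeasurableSet (unitCube d) := by
  have : unitCube d = ⋂ k, {x | x k ∈ Set.Icc (0 : ℝ) 1} := by
    ext x; simp [unitCube]
  rw [this]
  refine MeasurableSet.iInter fun k => ?_
  have h : Measurable fun x : EuclideanSpace ℝ (Fin d) => x k := by fun_prop
  exact h measurableSet_Icc

instance isProbabilityMeasure_restrict_unitCube (d : ℕ) : IsProbabilityMeasure
    ((volume : Measure (EuclideanSpace ℝ (Fin d))).restrict (unitCube d)) := by
  have h : unitCube d =
      (MeasurableEquiv.toLp 2 (Fin d → ℝ)).symm ⁻¹' (Set.univ.pi fun _ => Set.Icc (0 : ℝ) 1) := by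
    ext x
    simp only [unitCube, Set.mem_ofPred_eq, Set.mem_preimage, Set.mem_univ_pi]
    rfl
  constructor
  rw [Measure.restrict_apply_univ, h,
    (EuclideanSpace.volume_preserving_symm_measurableEquiv_toLp (Fin d)).measure_preimage_equiv,
    volume_pi, Measure.pi_pi]
  simp

instance isProbabilityMeasure_restrict_Icc :
    IsProbabilityMeasure ((volume : Measure ℝ).restrict (Set.Icc 0 1)) := ⟨by simp⟩

/-- A point of the cube has many points of the cube in its neighbourhood. -/
theorem ofReal_pow_le_measure_ball {d : ℕ} (hd : d ≤ 4) {c : EuclideanSpace ℝ (Fin d)}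
    (hc : c ∈ unitCube d) {a : ℝ} (ha0 : 0 ≤ a) (ha : a ≤ 1 / 2) :
    ENNReal.ofReal (a ^ d) ≤
      ((volume : Measure (EuclideanSpace ℝ (Fin d))).restrict (unitCube d))
        {z | dist z c ≤ 2 * a} := by
  -- In each coordinate the interval of length `a` at `c l` is directed inward, which fits since `a
  -- ≤ 1 / 2`. The diagonal `√d * a` is at most `2 * a` since `d ≤ 4`.
  let lo : Fin d → ℝ := fun l => if c l ≤ 1 / 2 then c l else c l - a
  have hlo : ∀ l, c l - a ≤ lo l ∧ lo l ≤ c l ∧ 0 ≤ lo l ∧ lo l + a ≤ 1 := by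
    intro l
    have h0 : 0 ≤ c l := (hc l).1
    have h1 : c l ≤ 1 := (hc l).2
    simp only [lo]
    split_ifs with h
    · exact ⟨by linarith, le_rfl, h0, by linarith⟩
    · exact ⟨le_rfl, by linarith, by linarith, by linarith⟩
  set box : Set (EuclideanSpace ℝ (Fin d)) := (MeasurableEquiv.toLp 2 (Fin d → ℝ)).symm ⁻¹'
    (Set.univ.pi fun l => Set.Icc (lo l) (lo l + a)) with hbox
  have hmem : ∀ z ∈ box, ∀ l, lo l ≤ z l ∧ z l ≤ lo l + a := fun z hz l => hz l trivial
  have hsub : box ⊆ {z | dist z c ≤ 2 * a} ∩ unitCube d := by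
    intro z hz
    refine ⟨?_, fun l => ⟨(hlo l).2.2.1.trans (hmem z hz l).1,
      (hmem z hz l).2.trans (hlo l).2.2.2⟩⟩
    refine (sq_le_sq₀ dist_nonneg (by positivity)).1 ?_
    rw [EuclideanSpace.dist_sq_eq]
    calc ∑ l, dist (z l) (c l) ^ 2 ≤ ∑ _l : Fin d, a ^ 2 := by
          refine Finset.sum_le_sum fun l _ => pow_le_pow_left₀ dist_nonneg ?_ 2
          rw [Real.dist_eq, abs_le]
          obtain ⟨h1, h2⟩ := hmem z hz l
          obtain ⟨h3, h4, -, -⟩ := hlo l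
          constructor <;> linarith
      _ = d * a ^ 2 := by simp
      _ ≤ 4 * a ^ 2 := by
          refine mul_le_mul_of_nonneg_right ?_ (sq_nonneg a)
          exact_mod_cast hd
      _ = (2 * a) ^ 2 := by ring
  have hvol : (volume : Measure (EuclideanSpace ℝ (Fin d))) box = ENNReal.ofReal (a ^ d) := by
    rw [hbox,
      (EuclideanSpace.volume_preserving_symm_measurableEquiv_toLp (Fin d)).measure_preimage_equiv,
      volume_pi, Measure.pi_pi]
    simp [ENNReal.ofReal_pow ha0]
  rw [← hvol, Measure.restrict_apply' (measurableSet_unitCube d)]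
  exact measure_mono hsub

/-- The ball of radius `2 s` about the point of the segment at distance `R - 2 s` from `x` consists
of relays: it stays within `R` of `x` and loses at most `4 s` of progress. -/
theorem measure_far_relay_ge {d : ℕ} (hd : d ≤ 4) {x y : EuclideanSpace ℝ (Fin d)}
    (hx : x ∈ unitCube d) (hy : y ∈ unitCube d) {R s : ℝ} (hs : 0 ≤ s) (hs1 : s ≤ 1 / 2)
    (hsR : 2 * s ≤ R) (hxy : R < dist x y) :
    ENNReal.ofReal (s ^ d) ≤
      ((volume : Measure (EuclideanSpace ℝ (Fin d))).restrict (unitCube d))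
        {z | dist x z ≤ R ∧ dist z y ≤ dist x y - (R - 4 * s)} := by
  have hD : 0 < dist x y := by linarith
  set θ := (R - 2 * s) / dist x y with hθ
  have hθD : θ * dist x y = R - 2 * s := by rw [hθ]; field_simp
  have hθ0 : 0 ≤ θ := div_nonneg (by linarith) hD.le
  have hθ1 : θ ≤ 1 := by rw [hθ, div_le_one hD]; linarith
  have hc := (convex_unitCube d).lineMap_mem hx hy ⟨hθ0, hθ1⟩
  refine (ofReal_pow_le_measure_ball hd hc hs hs1).trans (measure_mono fun z hz => ?_)
  have hz' : dist z (AffineMap.lineMap x y θ) ≤ 2 * s := hz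
  have h1 : dist x (AffineMap.lineMap x y θ) = θ * dist x y := by
    rw [dist_left_lineMap, Real.norm_of_nonneg hθ0]
  have h2 : dist (AffineMap.lineMap x y θ) y = (1 - θ) * dist x y := by
    rw [dist_lineMap_right, Real.norm_of_nonneg (by linarith)]
  have h3 := dist_triangle_right x z (AffineMap.lineMap x y θ)
  have h4 := dist_triangle z (AffineMap.lineMap x y θ) y
  exact ⟨by linarith, by linarith⟩

/-- The ball of radius `R / 2` about the midpoint consists of relays. -/
theorem measure_near_relay_ge {d : ℕ} (hd : d ≤ 4) {x y : EuclideanSpace ℝ (Fin d)}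
    (hx : x ∈ unitCube d) (hy : y ∈ unitCube d) {R : ℝ} (hR : 0 ≤ R) (hR1 : R ≤ 1)
    (hxy : dist x y ≤ R) :
    ENNReal.ofReal ((R / 4) ^ d) ≤
      ((volume : Measure (EuclideanSpace ℝ (Fin d))).restrict (unitCube d))
        {z | dist x z ≤ R ∧ dist z y ≤ R} := by
  have hc := (convex_unitCube d).midpoint_mem hx hy
  refine (ofReal_pow_le_measure_ball hd hc (a := R / 4) (by linarith) (by linarith)).trans
    (measure_mono fun z hz => ?_)
  have hz' : dist z (midpoint ℝ x y) ≤ 2 * (R / 4) := hz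
  have h1 : dist x (midpoint ℝ x y) = 2⁻¹ * dist x y := by
    rw [dist_left_midpoint]; norm_num
  have h2 : dist (midpoint ℝ x y) y = 2⁻¹ * dist x y := by
    rw [dist_midpoint_right]; norm_num
  have h3 := dist_triangle_right x z (midpoint ℝ x y)
  have h4 := dist_triangle z (midpoint ℝ x y) y
  exact ⟨by linarith, by linarith⟩

/-! ### Edge probabilities and the union bound -/

theorem le_detectionProb {α β R z : ℝ} (hα0 : 0 ≤ α) (hα1 : α ≤ 1) (hβ : 0 ≤ β) (hz : 0 ≤ z)
    (hzR : z ≤ R) : α ≤ detectionProb α β R z := by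
  unfold detectionProb
  split_ifs with h
  · exact hα1
  · refine le_min hα1 (le_mul_of_one_le_right hα0 ?_)
    rcases hβ.eq_or_lt with rfl | hβ'
    · simp
    · have hz0 : 0 < z := lt_of_le_of_ne hz fun h0 => h ⟨h0.symm, hβ'⟩
      exact Real.one_le_rpow_of_pos_of_le_one_of_nonpos (div_pos hz0 (hz0.trans_le hzR))
        (div_le_one_of_le₀ hzR (hz.trans hzR)) (by linarith)

/-- The threshold `α` does not depend on the positions, so this sufficient condition decouples marks
from geometry. -/
theorem connectivityGraph_adj_of_mark_le {n d : ℕ} {α β R : ℝ} (hα0 : 0 ≤ α) (hα1 : α ≤ 1)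
    (hβ : 0 ≤ β) {ω : NetworkOutcome n d} {i j : Fin n} (hij : i ≠ j)
    (hd : dist (ω.1 i) (ω.1 j) ≤ R) (hm : ω.2 s(i, j) ≤ α) :
    (connectivityGraph α β R ω).Adj i j :=
  ⟨hij, hd, hm.trans (le_detectionProb hα0 hα1 hβ dist_nonneg hd)⟩

theorem one_sub_ofReal_pow_le {n : ℕ} (hn : 3 ≤ n) {q : ℝ} (hq : 0 ≤ q)
    (h : 12 * Real.log n ≤ q * ((n : ℝ) - 2)) :
    (1 - ENNReal.ofReal q) ^ (n - 2) ≤ ENNReal.ofReal (1 / (n : ℝ) ^ 12) := by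
  have hn0 : (0 : ℝ) < n := by exact_mod_cast (by omega : 0 < n)
  rw [← ENNReal.ofReal_one, ← ENNReal.ofReal_sub 1 hq]
  calc ENNReal.ofReal (1 - q) ^ (n - 2) ≤ ENNReal.ofReal (Real.exp (-q)) ^ (n - 2) := by
        gcongr
        exact Real.one_sub_le_exp_neg q
    _ = ENNReal.ofReal (Real.exp (-(q * ((n : ℝ) - 2)))) := by
        rw [← ENNReal.ofReal_pow (Real.exp_pos _).le, ← Real.exp_nat_mul, Nat.cast_sub (by omega)]
        congr 2
        push_cast
        ring
    _ ≤ ENNReal.ofReal (1 / (n : ℝ) ^ 12) := by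
        refine ENNReal.ofReal_le_ofReal ?_
        have h1 : 1 / (n : ℝ) ^ 12 = Real.exp (-(12 * Real.log n)) := by
          rw [Real.exp_neg, one_div, show (12 : ℝ) * Real.log n = (12 : ℕ) * Real.log n by norm_num,
            Real.exp_nat_mul, Real.exp_log hn0]
        rw [h1]
        exact Real.exp_le_exp.2 (by linarith)

theorem restrict_Icc_Iic {α : ℝ} (hα1 : α ≤ 1) :
    ((volume : Measure ℝ).restrict (Set.Icc 0 1)) (Set.Iic α) = ENNReal.ofReal α := by
  rw [Measure.restrict_apply measurableSet_Iic]
  have : Set.Iic α ∩ Set.Icc 0 1 = Set.Icc 0 α := by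
    ext x
    simp only [Set.mem_inter_iff, Set.mem_Iic, Set.mem_Icc]
    exact ⟨fun h => ⟨h.2.1, h.1⟩, fun h => ⟨h.2, h.1, h.2.trans hα1⟩⟩
  simp [this]

/-- Outside an event of probability at most `2 / n^10`, far targets can be approached by one edge and
near ones are reached by two edges. -/
theorem exists_greedy_event {n d : ℕ} (hn : 3 ≤ n) (hd : d ≤ 4) {α β R s : ℝ} (hα0 : 0 < α)
    (hα1 : α ≤ 1) (hβ : 0 ≤ β) (hR1 : R ≤ 1) (hs : 0 < s) (hsR : 32 * s < R)
    (hfar : 12 * Real.log n ≤ α * s ^ d * ((n : ℝ) - 2))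
    (hnear : 12 * Real.log n ≤ α * α * (R / 4) ^ d * ((n : ℝ) - 2)) :
    ∃ A : Set (NetworkOutcome n d), MeasurableSet A ∧
      1 - 2 / (n : ℝ) ^ 10 ≤ (networkLaw n d).real A ∧
      ∀ ω ∈ A, (∀ i, ω.1 i ∈ unitCube d) ∧
        (∀ i j, R < dist (ω.1 i) (ω.1 j) → ∃ k, (connectivityGraph α β R ω).Adj i k ∧
          dist (ω.1 k) (ω.1 j) ≤ dist (ω.1 i) (ω.1 j) - (R - 4 * s)) ∧
        (∀ i j, i ≠ j → dist (ω.1 i) (ω.1 j) ≤ R →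
          ∃ k, (connectivityGraph α β R ω).Adj i k ∧ (connectivityGraph α β R ω).Adj k j) := by
  set E := EuclideanSpace ℝ (Fin d)
  have hR0 : 0 < R := by linarith
  have hn0 : (0 : ℝ) < n := by exact_mod_cast (by omega : 0 < n)
  have hcube : ∀ᵐ x ∂((volume : Measure E).restrict (unitCube d)), x ∈ unitCube d :=
    ae_restrict_mem (measurableSet_unitCube d)
  -- Pairs of the wrong kind are admitted outright, so that the volume bounds hold for all positions
  -- in the cube.
  let B₁ : Set (E × E × E) :=
    {q | dist q.1 q.2.1 ≤ R ∨ (dist q.1 q.2.2 ≤ R ∧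
      dist q.2.2 q.2.1 ≤ dist q.1 q.2.1 - (R - 4 * s))}
  let B₂ : Set (E × E × E) :=
    {q | R < dist q.1 q.2.1 ∨ (dist q.1 q.2.2 ≤ R ∧ dist q.2.2 q.2.1 ≤ R)}
  have hc₁ : Continuous fun q : E × E × E => dist q.1 q.2.1 := by fun_prop
  have hc₂ : Continuous fun q : E × E × E => dist q.1 q.2.2 := by fun_prop
  have hc₃ : Continuous fun q : E × E × E => dist q.2.2 q.2.1 := by fun_prop
  have hB₁ : MeasurableSet B₁ :=
    ((isClosed_le hc₁ continuous_const).union ((isClosed_le hc₂ continuous_const).inter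
      (isClosed_le hc₃ (hc₁.sub continuous_const)))).measurableSet
  have hB₂ : MeasurableSet B₂ :=
    (isOpen_lt continuous_const hc₁).measurableSet.union ((isClosed_le hc₂ continuous_const).inter
      (isClosed_le hc₃ continuous_const)).measurableSet
  let F : Set (E × E × E) → Set ℝ → Set ℝ → Fin n → Fin n → Set (NetworkOutcome n d) :=
    fun B T₁ T₂ i j => {ω | i ≠ j ∧ ∀ k, k ≠ i → k ≠ j →
      ¬((ω.1 i, ω.1 j, ω.1 k) ∈ B ∧ ω.2 s(i, k) ∈ T₁ ∧ ω.2 s(j, k) ∈ T₂)}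
  -- Only the edge to `i` matters here, hence `Set.univ` for the second mark.
  have hF₁ : ∀ i j, networkLaw n d (F B₁ (Set.Iic α) Set.univ i j) ≤
      ENNReal.ofReal (1 / (n : ℝ) ^ 12) := by
    intro i j
    by_cases hij : i = j
    · simp [F, hij]
    refine (measure_mono fun ω hω => hω.2).trans ((prod_pi_forall_not_relay_le hij hB₁
      measurableSet_Iic MeasurableSet.univ hcube (v := ENNReal.ofReal (s ^ d)) ?_).trans ?_)
    · intro x hx y hy
      rcases le_or_gt (dist x y) R with h | h
      · have : {z | (x, y, z) ∈ B₁} = Set.univ := Set.eq_univ_of_forall fun z => Or.inl h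
        rw [this, measure_univ, ENNReal.ofReal_le_one]
        exact pow_le_one₀ hs.le (by linarith)
      · exact (measure_far_relay_ge hd hx hy hs.le (by linarith) (by linarith) h).trans
          (measure_mono fun z hz => Or.inr hz)
    · rw [restrict_Icc_Iic hα1, measure_univ, mul_one, ← ENNReal.ofReal_mul hα0.le]
      exact one_sub_ofReal_pow_le hn (by positivity) hfar
  have hF₂ : ∀ i j, networkLaw n d (F B₂ (Set.Iic α) (Set.Iic α) i j) ≤
      ENNReal.ofReal (1 / (n : ℝ) ^ 12) := by
    intro i j
    by_cases hij : i = j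
    · simp [F, hij]
    refine (measure_mono fun ω hω => hω.2).trans ((prod_pi_forall_not_relay_le hij hB₂
      measurableSet_Iic measurableSet_Iic hcube (v := ENNReal.ofReal ((R / 4) ^ d)) ?_).trans ?_)
    · intro x hx y hy
      rcases lt_or_ge R (dist x y) with h | h
      · have : {z | (x, y, z) ∈ B₂} = Set.univ := Set.eq_univ_of_forall fun z => Or.inl h
        rw [this, measure_univ, ENNReal.ofReal_le_one]
        exact pow_le_one₀ (by positivity) (by linarith)
      · exact (measure_near_relay_ge hd hx hy hR0.le hR1 h).trans
          (measure_mono fun z hz => Or.inr hz)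
    · rw [restrict_Icc_Iic hα1, ← ENNReal.ofReal_mul hα0.le,
        ← ENNReal.ofReal_mul (by positivity)]
      exact one_sub_ofReal_pow_le hn (by positivity) hnear
  let N : Set (NetworkOutcome n d) := {ω | ¬∀ i, ω.1 i ∈ unitCube d}
  have hN : networkLaw n d N = 0 := by
    have h1 : ∀ᵐ x ∂(Measure.pi fun _ : Fin n => (volume : Measure E).restrict (unitCube d)),
        ∀ i, x i ∈ unitCube d := ae_all_iff.2 fun i =>
      (Measure.quasiMeasurePreserving_eval
        (fun _ : Fin n => (volume : Measure E).restrict (unitCube d)) i).ae hcube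
    exact Measure.quasiMeasurePreserving_fst.ae h1
  set bad : Set (NetworkOutcome n d) :=
    N ∪ ⋃ i, ⋃ j, (F B₁ (Set.Iic α) Set.univ i j ∪ F B₂ (Set.Iic α) (Set.Iic α) i j) with hbad
  have hbad_le : networkLaw n d bad ≤ ENNReal.ofReal (2 / (n : ℝ) ^ 10) := by
    calc networkLaw n d bad
        ≤ networkLaw n d N + ∑ i, ∑ j, (networkLaw n d (F B₁ (Set.Iic α) Set.univ i j) +
            networkLaw n d (F B₂ (Set.Iic α) (Set.Iic α) i j)) := by
          refine (measure_union_le _ _).trans (add_le_add_right ?_ _)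
          refine (measure_iUnion_fintype_le _ _).trans (Finset.sum_le_sum fun i _ => ?_)
          refine (measure_iUnion_fintype_le _ _).trans (Finset.sum_le_sum fun j _ => ?_)
          exact measure_union_le _ _
      _ ≤ 0 + ∑ _i : Fin n, ∑ _j : Fin n, (ENNReal.ofReal (1 / (n : ℝ) ^ 12) +
            ENNReal.ofReal (1 / (n : ℝ) ^ 12)) := by
          refine add_le_add hN.le (Finset.sum_le_sum fun i _ => Finset.sum_le_sum fun j _ => ?_)
          exact add_le_add (hF₁ i j) (hF₂ i j)
      _ = ENNReal.ofReal (2 / (n : ℝ) ^ 10) := by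
          rw [← ENNReal.ofReal_add (by positivity) (by positivity)]
          simp only [Finset.sum_const, Finset.card_univ, Fintype.card_fin, nsmul_eq_mul, zero_add]
          rw [← ENNReal.ofReal_natCast, ← ENNReal.ofReal_mul (by positivity),
            ← ENNReal.ofReal_mul (by positivity)]
          congr 1
          field_simp
          norm_num
  -- A measurable hull of equal measure avoids proving `bad` measurable.
  refine ⟨(toMeasurable (networkLaw n d) bad)ᶜ, (measurableSet_toMeasurable _ _).compl, ?_,
    fun ω hω => ?_⟩
  · rw [probReal_compl_eq_one_sub (measurableSet_toMeasurable _ _)]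
    have h1 : (networkLaw n d).real (toMeasurable (networkLaw n d) bad) ≤ 2 / (n : ℝ) ^ 10 := by
      rw [Measure.real, measure_toMeasurable]
      exact ENNReal.toReal_le_of_le_ofReal (by positivity) hbad_le
    linarith
  · have hω' : ω ∉ bad := fun h => hω (subset_toMeasurable _ _ h)
    simp only [hbad, Set.mem_union, Set.mem_iUnion, not_or, not_exists] at hω'
    obtain ⟨h0, hrel⟩ := hω'
    have hrelay : ∀ B T₁ T₂ i j, i ≠ j → ω ∉ F B T₁ T₂ i j → ∃ k, k ≠ i ∧ k ≠ j ∧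
        (ω.1 i, ω.1 j, ω.1 k) ∈ B ∧ ω.2 s(i, k) ∈ T₁ ∧ ω.2 s(j, k) ∈ T₂ := by
      intro B T₁ T₂ i j hij h
      by_contra! hcon
      exact h ⟨hij, fun k hki hkj hk => hcon k hki hkj hk.1 hk.2.1 hk.2.2⟩
    refine ⟨not_not.1 h0, fun i j hij => ?_, fun i j hij hd => ?_⟩
    · have hne : i ≠ j := by
        rintro rfl
        rw [dist_self] at hij
        linarith
      obtain ⟨k, hki, -, hk, hm, -⟩ := hrelay _ _ _ i j hne (hrel i j).1
      rcases hk with hk | hk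
      · exact absurd hk (not_le.2 hij)
      · exact ⟨k, connectivityGraph_adj_of_mark_le hα0.le hα1 hβ hki.symm hk.1 hm, hk.2⟩
    · obtain ⟨k, hki, hkj, hk, hm, hm'⟩ := hrelay _ _ _ i j hij (hrel i j).2
      rcases hk with hk | hk
      · exact absurd hk (not_lt.2 hd)
      · exact ⟨k, connectivityGraph_adj_of_mark_le hα0.le hα1 hβ hki.symm hk.1 hm,
          connectivityGraph_adj_of_mark_le hα0.le hα1 hβ hkj hk.2 (Sym2.eq_swap ▸ hm')⟩

/-! ### Choice of the scale -/

theorem mainTheorem1 (n d : ℕ) (hn : 3 ≤ n) (hd : d = 2 ∨ d = 3) (α β R : ℝ)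
    (hα : α ∈ Set.Ioc (0 : ℝ) 1) (hβ : β ∈ Set.Ico (0 : ℝ) 3)
    (hR : (1 / α) ^ (1 / (d : ℝ)) * rMDS n d α < R) (hR1 : R ≤ 1) :
    ∃ A : Set (NetworkOutcome n d), MeasurableSet A ∧
      1 - 1 / (n : ℝ) ^ 4 < (networkLaw n d).real A ∧
      ∀ ω ∈ A, (connectivityGraph α β R ω).Connected ∧
        ∀ Y : Matrix (Fin n) (Fin d) ℝ, IsMDSMAP R (connectivityGraph α β R ω) Y →
          dInv (positionMatrix ω) Y ≤ rMDS n d α / R + 20 * R := by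
  obtain ⟨hα0, hα1⟩ := hα
  have hd3 : d ≤ 3 := by omega
  have hd0 : d ≠ 0 := by omega
  have hn3 : (3 : ℝ) ≤ n := by exact_mod_cast hn
  have hlog : 0 < Real.log n := Real.log_pos (by linarith)
  have hn2 : (0 : ℝ) < n - 2 := by linarith
  set b : ℝ := 12 * Real.log n / (α * ((n : ℝ) - 2)) with hb
  have hb0 : 0 < b := by positivity
  set s : ℝ := b ^ (1 / (d : ℝ)) with hs
  have hs0 : 0 < s := Real.rpow_pos_of_pos hb0 _
  have hsd : s ^ d = b := by
    rw [hs, one_div, Real.rpow_inv_natCast_pow hb0.le hd0]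
  have hr : rMDS n d α = 32 * s := rfl
  have hfar' : α * s ^ d * ((n : ℝ) - 2) = 12 * Real.log n := by
    rw [hsd, hb]
    field_simp
  set u : ℝ := (1 / α) ^ (1 / (d : ℝ)) with hu
  have hu1 : 1 ≤ u := Real.one_le_rpow ((one_le_div hα0).2 hα1) (by positivity)
  have hud : α * u ^ d = 1 := by
    rw [hu, one_div (d : ℝ), Real.rpow_inv_natCast_pow (by positivity) hd0]
    field_simp
  rw [hr] at hR ⊢
  have hsR : 32 * s < R := lt_of_le_of_lt (le_mul_of_one_le_left (by positivity) hu1) hR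
  -- A near relay pays a second factor `α`; the factor `u` in the lower bound on `R` compensates, as
  -- `α * u ^ d = 1`.
  have hnear' : α * s ^ d ≤ α * α * (R / 4) ^ d := by
    have h1 : (u * s) ^ d ≤ (R / 4) ^ d := by
      refine pow_le_pow_left₀ (by positivity) ?_ d
      have : 0 < u * s := by positivity
      linarith
    rw [mul_pow] at h1
    calc α * s ^ d = α * α * (u ^ d * s ^ d) := by linear_combination (-(α * s ^ d)) * hud
      _ ≤ α * α * (R / 4) ^ d := mul_le_mul_of_nonneg_left h1 (by positivity)
  obtain ⟨A, hA, hAp, hAω⟩ := exists_greedy_event (d := d) hn (by omega) hα0 hα1 hβ.1 hR1 hs0 hsR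
    hfar'.ge (hfar'.ge.trans (mul_le_mul_of_nonneg_right hnear' hn2.le))
  refine ⟨A, hA, lt_of_lt_of_le ?_ hAp, fun ω hω => ?_⟩
  · have h1 : (2 : ℝ) < (n : ℝ) ^ 6 := by
      calc (2 : ℝ) < 3 ^ 6 := by norm_num
        _ ≤ (n : ℝ) ^ 6 := pow_le_pow_left₀ (by norm_num) hn3 6
    have h2 : 2 / (n : ℝ) ^ 10 < 1 / (n : ℝ) ^ 4 := by
      rw [div_lt_div_iff₀ (by positivity) (by positivity)]
      have : (0 : ℝ) < (n : ℝ) ^ 4 := by positivity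
      nlinarith
    linarith
  · obtain ⟨h1, h2, h3⟩ := hAω ω hω
    exact connected_and_dInv_le_of_greedy (by omega) hd3 hR1 hs0 hsR h1 h2 h3
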